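/- **Setting.** Let $T\ge 1$, $X_t\in\mathbb{R}^{d\times p}$, $y_t\in\mathbb{R}^d$ $(1\le t\le T)$, $\lambda_1,\lambda_2\ge 0$, $w_1,\dots,w_{T-1}>0$, and for $\beta=(\beta_1,\dots,\beta_T)\in\mathbb{R}^{pT}$ let $$F(\beta)=\tfrac12\sum_{t=1}^T\|y_t-X_t\beta_t\|_2^2+\lambda_1\sum_{t=1}^T\|\beta_t\|_1+\lambda_2\sum_{t=1}^{T-1}w_t\|\beta_{t+1}-\beta_t\|_2 .$$ The *fusion chains* of $\beta$ are the maximal intervals of $\{1,\dots,T\}$ on which $t\mapsto\beta_t$ is constant. **Algorithm.** Given a starting point $\beta^0$ and a tolerance $\epsilon>0$, iterates $\beta^n$ are produced as follows; an iteration $\beta^{n-1}\to\beta^n$ is said to *make progress* if $F(\beta^n)<(1-\epsilon)F(\beta^{n-1})$. 1. *Block descent.* For $t=t_1,\dots,t_T$ (a sweeping pattern), replace block $t$ by a minimizer of $F$ with respect to $\beta_t$, the other blocks being fixed. Repeat as long as this makes progress, then go to 2. 2. *Single-chain fusion.* Start with the fusion chains of the current point. For $t=t_1,\dots,t_T$: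 if $t$ starts a chain with at least two elements, minimize $F$ over the common value of the blocks in that chain; if $t$ ends a chain that is not the last, minimize $F$ over a common value of the blocks in this chain and the next, and accept the result and merge the two chains if this decreases $F$ (otherwise leave everything unchanged). Repeat as long as this makes progress. If any of these cycles made progress go to 1, otherwise go to 3. 3. *All chains.* Minimize $F$ over all points that are constant on each fusion chain of the current point (if the descent reaches a point at which some chains have become equal, these may be merged and the minimization restarted with the reduced set of chains). Let $g$ be the subgradient of minimal Euclidean norm of $F$ at the new point. If $g\ne0$ go to 4. If $g=0$, terminate unless iteration 3 made progress, in which case go to 1. 4. *Subgradient step.* $\beta^n=\beta^{n-1}-\alpha^* g$ with $\alpha^*\in\operatorname{argmin}_{\alpha>0}F(\beta^{n-1}-\alpha g)$. If this made progress go to 1, otherwise stop. The minimizations are exact; where minimizers are not unique, any may be returned. After termination the sequence is continued by its last element. **Theorem.** Let $\beta^0\in\mathbb{R}^{pT}$ be any starting point. (a) Let the tolerance take successively the values of a sequence $\epsilon_0,\epsilon_1,\dots>0$ (for instance one decreasing to $0$): whenever the algorithm with tolerance $\epsilon_k$ stops in 4, it is started again at the current point with tolerance $\epsilon_{k+1}$.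 Then $F(\beta^n)$ is nonincreasing and converges to $\min F$, and $(\beta^n)_{n\ge0}$ converges to a global minimizer of $F$. (b) Let $M\subset\mathbb{R}^{pT}$ be finite. There is $\epsilon^*>0$ such that for every $\epsilon\in(0,\epsilon^*)$ and every run of the algorithm with the single tolerance $\epsilon$ in which all outputs of 3 belong to $M$ (as when 3 returns one fixed minimizer for each segmentation of $\{1,\dots,T\}$), the run never stops in 4, $F(\beta^n)$ is nonincreasing and converges to $\min F$, and $(\beta^n)_{n\ge0}$ converges to a global minimizer of $F$. -/

import Mathlib

namespace SGFL

/-- A coefficient sequence `β = (β_1, …, β_T)` with `β_t ∈ ℝ^p`, where `T = m + 1 ≥ 1`; the times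
`1, …, T` are the elements of `Fin (m + 1)`. -/
abbrev Coef (p m : ℕ) : Type := Fin (m + 1) → EuclideanSpace ℝ (Fin p)

/-- The data of a sparse group fused lasso problem: responses `y_t ∈ ℝ^d`, predictor matrices
`X_t ∈ ℝ^{d × p}`, regularization parameters and positive weights `w_1, …, w_{T-1}`. -/
structure Problem (d p m : ℕ) where
  X : Fin (m + 1) → Matrix (Fin d) (Fin p) ℝ
  y : Fin (m + 1) → Fin d → ℝ
  lam₁ : ℝ
  lam₂ : ℝ
  w : Fin m → ℝ
  lam₁_nonneg : 0 ≤ lam₁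
  lam₂_nonneg : 0 ≤ lam₂
  w_pos : ∀ t, 0 < w t

variable {d p m : ℕ}

/-- The objective
`F(β) = 1/2 ∑ ‖y_t - X_t β_t‖₂² + λ₁ ∑ ‖β_t‖₁ + λ₂ ∑_{t<T} w_t ‖β_{t+1} - β_t‖₂`. -/
noncomputable def Problem.F (P : Problem d p m) (β : Coef p m) : ℝ :=
  1 / 2 * ∑ t, ∑ i, (P.y t i - (P.X t).mulVec (β t).ofLp i) ^ 2
    + P.lam₁ * ∑ t, ∑ i, |β t i|
    + P.lam₂ * ∑ t : Fin m, P.w t * ‖β t.succ - β t.castSucc‖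

/-- `β` is a global minimizer of `F`. -/
def Problem.IsGlobalMin (P : Problem d p m) (β : Coef p m) : Prop :=
  ∀ γ : Coef p m, P.F β ≤ P.F γ

/-! ### Sweeps -/

/-- Apply a nondeterministic update, indexed by a time, along a list of times. -/
inductive Sweep {S : Type} (step : Fin (m + 1) → S → S → Prop) :
    List (Fin (m + 1)) → S → S → Prop
  | nil (s : S) : Sweep step [] s s
  | cons {t : Fin (m + 1)} {l : List (Fin (m + 1))} {s s' s'' : S} :
      step t s s' → Sweep step l s' s'' → Sweep step (t :: l) s s''

/-! ### First level: block coordinate descent -/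

/-- Block `t` is replaced by a minimizer of `F` with respect to this block, the other blocks being
kept fixed. -/
def Problem.BlockStep (P : Problem d p m) (t : Fin (m + 1)) (β β' : Coef p m) : Prop :=
  ∃ x : EuclideanSpace ℝ (Fin p),
    (∀ z, P.F (Function.update β t x) ≤ P.F (Function.update β t z)) ∧
      β' = Function.update β t x

/-- One cycle of block coordinate descent, for some sweeping pattern `(t_1, …, t_T)`. -/
def Problem.BlockDescent (P : Problem d p m) (β β' : Coef p m) : Prop :=
  ∃ l : List (Fin (m + 1)), l.length = m + 1 ∧ Sweep P.BlockStep l β β'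

/-! ### Second level: fusion cycle over single chains

A partition of the times into consecutive chains is recorded by its set `S` of cuts: `t ∈ S` means
that `t.castSucc` is the end of a chain and `t.succ` the start of the next one. -/

/-- The cuts of the segmentation of `β`: the times `t` with `β_t ≠ β_{t+1}`. -/
def cuts (β : Coef p m) : Set (Fin m) := {t | β t.castSucc ≠ β t.succ}

/-- `{a, …, b}` is one of the chains of the partition with cuts `S`. -/
structure IsChain (S : Set (Fin m)) (a b : Fin (m + 1)) : Prop where
  le : a ≤ b
  first : ∀ t : Fin m, t.succ = a → t ∈ S
  last : ∀ t : Fin m, t.castSucc = b → t ∈ S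
  inside : ∀ t : Fin m, a ≤ t.castSucc → t.succ ≤ b → t ∉ S

/-- Give the common value `x` to the blocks with indices in `{a, …, b}`. -/
def fill (β : Coef p m) (a b : Fin (m + 1)) (x : EuclideanSpace ℝ (Fin p)) : Coef p m :=
  fun t => if a ≤ t ∧ t ≤ b then x else β t

/-- `x` is an optimal common value of the blocks in `{a, …, b}`, the others being kept fixed. -/
def Problem.IsBestFill (P : Problem d p m) (β : Coef p m) (a b : Fin (m + 1))
    (x : EuclideanSpace ℝ (Fin p)) : Prop :=
  ∀ z, P.F (fill β a b x) ≤ P.F (fill β a b z)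

/-- The operation of the fusion cycle at time `t`, on the current coefficients and the current
cuts. At the start of a chain with at least two elements, `F` is optimized over the common value
on the chain. At the end of a chain that is not the last one, `F` is optimized over a common value
on this chain and the next; the chains are merged if this reduces `F`, and otherwise nothing
changes. At any other time nothing changes. -/
inductive Problem.FusionStep (P : Problem d p m) (t : Fin (m + 1)) :
    Coef p m × Set (Fin m) → Coef p m × Set (Fin m) → Prop
  | chain {β : Coef p m} {S : Set (Fin m)} {b : Fin (m + 1)} {x : EuclideanSpace ℝ (Fin p)} :
      IsChain S t b → t < b → P.IsBestFill β t b x →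
      FusionStep P t (β, S) (fill β t b x, S)
  | merge {β : Coef p m} {S : Set (Fin m)} {a b : Fin (m + 1)} {c : Fin m}
      {x : EuclideanSpace ℝ (Fin p)} :
      t = c.castSucc → IsChain S a c.castSucc → IsChain S c.succ b → P.IsBestFill β a b x →
      P.F (fill β a b x) < P.F β →
      FusionStep P t (β, S) (fill β a b x, S \ {c})
  | reject {β : Coef p m} {S : Set (Fin m)} {a b : Fin (m + 1)} {c : Fin m}
      {x : EuclideanSpace ℝ (Fin p)} :
      t = c.castSucc → IsChain S a c.castSucc → IsChain S c.succ b → P.IsBestFill β a b x →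
      P.F β ≤ P.F (fill β a b x) →
      FusionStep P t (β, S) (β, S)
  | skip {β : Coef p m} {S : Set (Fin m)} :
      (¬ ∃ b, t < b ∧ IsChain S t b) → (¬ ∃ c ∈ S, t = c.castSucc) →
      FusionStep P t (β, S) (β, S)

/-- One fusion cycle over single chains, for some sweeping pattern `(t_1, …, t_T)`. It starts with
the chains on which `β` is constant. -/
def Problem.FusionCycle (P : Problem d p m) (β β' : Coef p m) : Prop :=
  ∃ (l : List (Fin (m + 1))) (S' : Set (Fin m)),
    l.length = m + 1 ∧ Sweep P.FusionStep l (β, cuts β) (β', S')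

/-! ### Third level: all fusion chains -/

/-- The coefficient sequences that are constant on every fusion chain of `β`. -/
def chainSpace (β : Coef p m) : Set (Coef p m) :=
  {γ | ∀ t : Fin m, β t.castSucc = β t.succ → γ t.castSucc = γ t.succ}

/-- Optimization of `F` over all fusion chains simultaneously: either a minimizer under the equality
constraints of the current chains is returned, or the descent reaches a point at which some of the
chains have become equal; then these are merged and the optimization restarts with the reduced
set of chains. -/
inductive Problem.AllChains (P : Problem d p m) : Coef p m → Coef p m → Prop
  | solve {β β' : Coef p m} :
      β' ∈ chainSpace β → (∀ γ ∈ chainSpace β, P.F β' ≤ P.F γ) → AllChains P β β'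
  | merge {β γ β' : Coef p m} :
      γ ∈ chainSpace β → (∃ t : Fin m, β t.castSucc ≠ β t.succ ∧ γ t.castSucc = γ t.succ) →
      P.F γ ≤ P.F β → AllChains P γ β' → AllChains P β β'

/-! ### Fourth level: subgradient step -/

/-- `g ∈ ∂F(β)`, for the Euclidean inner product of `ℝ^{pT}`. -/
def Problem.IsSubgradient (P : Problem d p m) (β g : Coef p m) : Prop :=
  ∀ γ : Coef p m, P.F β + ∑ t, inner ℝ (g t) (γ t - β t) ≤ P.F γ

/-- `g` is a subgradient of `F` at `β` of minimal Euclidean norm in `ℝ^{pT}`. -/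
def Problem.IsMinNormSubgradient (P : Problem d p m) (β g : Coef p m) : Prop :=
  P.IsSubgradient β g ∧
    ∀ h : Coef p m, P.IsSubgradient β h → ∑ t, ‖g t‖ ^ 2 ≤ ∑ t, ‖h t‖ ^ 2

/-- `a ∈ argmin_{a > 0} F(β - a g)`. -/
def Problem.IsExactStep (P : Problem d p m) (β g : Coef p m) (a : ℝ) : Prop :=
  0 < a ∧ ∀ a' : ℝ, 0 < a' → P.F (β - a • g) ≤ P.F (β - a' • g)

/-! ### The hybrid algorithm -/

/-- Control states: the component to be applied next, or the way in which the run has ended.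
`fusion b` remembers in `b` whether the fusion cycles since the last block descent have reduced `F`.
`finished` is termination with a zero subgradient, `stopped` is termination by the
relative-decrease test after a subgradient step. -/
inductive Phase where
  | descent
  | fusion (reduced : Bool)
  | allChains
  | subgradient
  | finished
  | stopped

/-- One iteration of the hybrid algorithm with tolerance `ε`, from `β^n` to `β^{n+1}`. -/
inductive Problem.AlgStep (P : Problem d p m) (ε : ℝ) :
    Phase × Coef p m → Phase × Coef p m → Prop
  | descent_again {β β' : Coef p m} :
      P.BlockDescent β β' → P.F β' < (1 - ε) * P.F β →
      AlgStep P ε (.descent, β) (.descent, β')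
  | descent_end {β β' : Coef p m} :
      P.BlockDescent β β' → (1 - ε) * P.F β ≤ P.F β' →
      AlgStep P ε (.descent, β) (.fusion false, β')
  | fusion_again {r : Bool} {β β' : Coef p m} :
      P.FusionCycle β β' → P.F β' < (1 - ε) * P.F β →
      AlgStep P ε (.fusion r, β) (.fusion true, β')
  | fusion_back {β β' : Coef p m} :
      P.FusionCycle β β' → (1 - ε) * P.F β ≤ P.F β' →
      AlgStep P ε (.fusion true, β) (.descent, β')
  | fusion_end {β β' : Coef p m} :
      P.FusionCycle β β' → (1 - ε) * P.F β ≤ P.F β' →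
      AlgStep P ε (.fusion false, β) (.allChains, β')
  | allChains_nonzero {β β' g : Coef p m} :
      P.AllChains β β' → P.IsMinNormSubgradient β' g → g ≠ 0 →
      AlgStep P ε (.allChains, β) (.subgradient, β')
  | allChains_again {β β' : Coef p m} :
      P.AllChains β β' → P.IsMinNormSubgradient β' 0 → P.F β' < (1 - ε) * P.F β →
      AlgStep P ε (.allChains, β) (.descent, β')
  | allChains_finished {β β' : Coef p m} :
      P.AllChains β β' → P.IsMinNormSubgradient β' 0 → (1 - ε) * P.F β ≤ P.F β' →
      AlgStep P ε (.allChains, β) (.finished, β')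
  | subgradient_again {β g : Coef p m} {a : ℝ} :
      P.IsMinNormSubgradient β g → P.IsExactStep β g a →
      P.F (β - a • g) < (1 - ε) * P.F β →
      AlgStep P ε (.subgradient, β) (.descent, β - a • g)
  | subgradient_stopped {β g : Coef p m} {a : ℝ} :
      P.IsMinNormSubgradient β g → P.IsExactStep β g a →
      (1 - ε) * P.F β ≤ P.F (β - a • g) →
      AlgStep P ε (.subgradient, β) (.stopped, β - a • g)

/-- `(ph n, β n)` is a run of the algorithm with tolerance `ε` and starting point `β 0`. After
termination the sequence is continued by its last element. -/
structure Problem.IsRun (P : Problem d p m) (ε : ℝ) (ph : ℕ → Phase) (β : ℕ → Coef p m) :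
    Prop where
  init : ph 0 = .descent
  step : ∀ n, ph n ≠ .finished → ph n ≠ .stopped →
    P.AlgStep ε (ph n, β n) (ph (n + 1), β (n + 1))
  halt : ∀ n, ph n = .finished ∨ ph n = .stopped →
    ph (n + 1) = ph n ∧ β (n + 1) = β n

/-- A run in which the tolerance takes successively the values `ε 0, ε 1, …`: whenever the
algorithm with tolerance `ε k` is stopped by the relative-decrease test although the subgradient was
nonzero, the algorithm is started again at the current point with tolerance `ε (k + 1)`. Here `k n`
is the index of the tolerance in force at iteration `n`. After termination with a zero subgradient
the sequence is continued by its last element. -/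
structure Problem.IsContinuedRun (P : Problem d p m) (ε : ℕ → ℝ) (k : ℕ → ℕ) (ph : ℕ → Phase)
    (β : ℕ → Coef p m) : Prop where
  init : ph 0 = .descent ∧ k 0 = 0
  step : ∀ n, ph n ≠ .finished → ph n ≠ .stopped →
    P.AlgStep (ε (k n)) (ph n, β n) (ph (n + 1), β (n + 1)) ∧ k (n + 1) = k n
  restart : ∀ n, ph n = .stopped →
    ph (n + 1) = .descent ∧ β (n + 1) = β n ∧ k (n + 1) = k n + 1
  halt : ∀ n, ph n = .finished →
    ph (n + 1) = .finished ∧ β (n + 1) = β n ∧ k (n + 1) = k n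

/-- The values `F(β^n)` never increase and tend to the minimum of `F`, and `β^n` converges to a
global minimizer of `F`. -/
def Problem.ConvergesToMin (P : Problem d p m) (β : ℕ → Coef p m) : Prop :=
  Antitone (fun n => P.F (β n)) ∧
    ∃ b : Coef p m, P.IsGlobalMin b ∧ Filter.Tendsto β Filter.atTop (nhds b) ∧
      Filter.Tendsto (fun n => P.F (β n)) Filter.atTop (nhds (P.F b))

end SGFL

/-!
Every iteration leaves `F` no larger: the moves of the first three levels are minimizations over sets
that contain the current point, and the subgradient step is an exact line search. That step is even
strict (`IsExactStep.lt`). If `F` did not decrease along `-g`, separating the ray from the strict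
epigraph of `F` would give a subgradient `s` with `⟪g, s⟫ ≤ 0`, whereas the element `g` of minimal norm
of the convex set `∂F(β)` satisfies `‖g‖² ≤ ⟪g, s⟫`.

The value of `F` returned by the third level is a minimum of `F` over a space that depends on a set of
cuts only, so there are finitely many such values. Two visits of the third level in an unfinished run
are separated by a strict decrease, up to distinguishing the two ways in which the run goes on;
hence an unfinished run visits the third level finitely often (`finite_allChains`), and in particular
it is restarted finitely often. A run that finishes does so at a point with subgradient `0`, a minimizer.

What remains is a run that ends up in block descent and fusion cycles for ever, with a fixed
tolerance `ε` (`IsCycling`). There one of any three consecutive iterations makes progress, so `F` tends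
to `0` geometrically, and `min F = 0`. The minimizers need not be unique, so convergence of the
points needs an argument, which depends on the penalties.
* If `λ₁ > 0`, then `λ₁ ‖β_t‖ ≤ F(β)`, and the points tend to `0`.
* If `λ₂ > 0`, all blocks are within a multiple of `F(β)` of each other. A move that leaves some block
  unchanged is therefore as short as a multiple of `F(β)`. A move of all blocks sets `F` to its minimum
  over constant sequences, which cannot happen again after a strict decrease. So the steps are
  eventually summable.
* If `λ₁ = λ₂ = 0`, the losses of the blocks after a move depend on the interval moved only, since
  fitted values of least squares are unique. Then `F` takes finitely many values along the run, which
  excludes infinitely many strict decreases.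

For a fixed tolerance and finitely many possible outputs of the third level, the relative decrease of
the subgradient step is determined by the point at which it starts, because the subgradient of minimal
norm is unique. Below the smallest of these decreases the run never stops in the fourth level, so that
it is a continued run without restarts.
-/

namespace SGFL

variable {d p m : ℕ}

/-! ### The objective -/

/-- The least squares loss of block `t`, without the penalties. -/
noncomputable def Problem.loss (P : Problem d p m) (t : Fin (m + 1))
    (x : EuclideanSpace ℝ (Fin p)) : ℝ :=
  1 / 2 * ∑ i, (P.y t i - (P.X t).mulVec x.ofLp i) ^ 2

namespace Problem

lemma F_nonneg (P : Problem d p m) (β : Coef p m) : 0 ≤ P.F β := by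
  have h₁ := P.lam₁_nonneg
  have h₂ := P.lam₂_nonneg
  have h₃ : 0 ≤ ∑ t : Fin m, P.w t * ‖β t.succ - β t.castSucc‖ :=
    Finset.sum_nonneg fun t _ => mul_nonneg (P.w_pos t).le (norm_nonneg _)
  unfold F
  positivity

lemma continuous_F (P : Problem d p m) : Continuous P.F := by
  have h : ∀ (t : Fin (m + 1)) (i : Fin d),
      Continuous fun β : Coef p m => (P.X t).mulVec (β t).ofLp i := by
    intro t i
    simp only [Matrix.mulVec, dotProduct]
    fun_prop
  unfold F
  fun_prop

lemma convexOn_F (P : Problem d p m) : ConvexOn ℝ Set.univ P.F := by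
  refine ⟨convex_univ, fun β _ γ _ a b ha hb hab => ?_⟩
  obtain rfl : b = 1 - a := by linarith
  have h₁ : ∑ t, ∑ i, (P.y t i - (P.X t).mulVec ((a • β + (1 - a) • γ) t).ofLp i) ^ 2 ≤
      a * ∑ t, ∑ i, (P.y t i - (P.X t).mulVec (β t).ofLp i) ^ 2 +
      (1 - a) * ∑ t, ∑ i, (P.y t i - (P.X t).mulVec (γ t).ofLp i) ^ 2 := by
    simp only [Finset.mul_sum, ← Finset.sum_add_distrib]
    refine Finset.sum_le_sum fun t _ => Finset.sum_le_sum fun i _ => ?_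
    have : (P.X t).mulVec ((a • β + (1 - a) • γ) t).ofLp i =
        a * (P.X t).mulVec (β t).ofLp i + (1 - a) * (P.X t).mulVec (γ t).ofLp i := by
      simp [Matrix.mulVec_add, Matrix.mulVec_smul]
    rw [this]
    nlinarith [mul_nonneg (mul_nonneg ha hb)
      (sq_nonneg ((P.X t).mulVec (β t).ofLp i - (P.X t).mulVec (γ t).ofLp i))]
  have h₂ : ∑ t, ∑ i, |(a • β + (1 - a) • γ) t i| ≤
      a * ∑ t, ∑ i, |β t i| + (1 - a) * ∑ t, ∑ i, |γ t i| := by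
    simp only [Finset.mul_sum, ← Finset.sum_add_distrib]
    refine Finset.sum_le_sum fun t _ => Finset.sum_le_sum fun i _ => ?_
    refine (abs_add_le _ _).trans_eq ?_
    simp [abs_mul, abs_of_nonneg ha, abs_of_nonneg hb]
  have h₃ : ∑ t : Fin m, P.w t * ‖(a • β + (1 - a) • γ) t.succ - (a • β + (1 - a) • γ) t.castSucc‖ ≤
      a * ∑ t : Fin m, P.w t * ‖β t.succ - β t.castSucc‖ +
      (1 - a) * ∑ t : Fin m, P.w t * ‖γ t.succ - γ t.castSucc‖ := by
    simp only [Finset.mul_sum, ← Finset.sum_add_distrib]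
    refine Finset.sum_le_sum fun t _ => ?_
    have e : (a • β + (1 - a) • γ) t.succ - (a • β + (1 - a) • γ) t.castSucc =
        a • (β t.succ - β t.castSucc) + (1 - a) • (γ t.succ - γ t.castSucc) := by
      simp only [Pi.add_apply, Pi.smul_apply]; module
    have := norm_add_le (a • (β t.succ - β t.castSucc)) ((1 - a) • (γ t.succ - γ t.castSucc))
    rw [norm_smul, norm_smul, Real.norm_of_nonneg ha, Real.norm_of_nonneg hb] at this
    rw [e]
    nlinarith [P.w_pos t]
  have h₂' := mul_le_mul_of_nonneg_left h₂ P.lam₁_nonneg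
  have h₃' := mul_le_mul_of_nonneg_left h₃ P.lam₂_nonneg
  simp only [F, smul_eq_mul]
  linarith

/-! ### Subgradients of minimal norm -/

/-- The variational inequality for the projection of `0` onto the convex set `∂F(β)`. -/
lemma IsMinNormSubgradient.sum_sq_le_inner {P : Problem d p m} {β g h : Coef p m}
    (hg : P.IsMinNormSubgradient β g) (hh : P.IsSubgradient β h) :
    ∑ t, ‖g t‖ ^ 2 ≤ ∑ t, inner ℝ (g t) (h t) := by
  set A := ∑ t, ‖g t‖ ^ 2
  set B := ∑ t, inner ℝ (g t) (h t)
  set C := ∑ t, ‖h t - g t‖ ^ 2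
  have hC : 0 ≤ C := Finset.sum_nonneg fun t _ => sq_nonneg _
  have key : ∀ τ : ℝ, 0 ≤ τ → τ ≤ 1 → 0 ≤ 2 * τ * (B - A) + τ ^ 2 * C := by
    intro τ h0 h1
    have hs : P.IsSubgradient β (fun t => g t + τ • (h t - g t)) := by
      intro γ
      have e₁ := mul_le_mul_of_nonneg_left (hg.1 γ) (sub_nonneg.2 h1)
      have e₂ := mul_le_mul_of_nonneg_left (hh γ) h0
      have : ∑ t, inner ℝ (g t + τ • (h t - g t)) (γ t - β t) =
          (1 - τ) * ∑ t, inner ℝ (g t) (γ t - β t) + τ * ∑ t, inner ℝ (h t) (γ t - β t) := by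
        simp only [Finset.mul_sum, ← Finset.sum_add_distrib]
        refine Finset.sum_congr rfl fun t _ => ?_
        simp only [inner_add_left, inner_smul_left, inner_sub_left, RCLike.conj_to_real]
        ring
      rw [this]
      linarith
    have := hg.2 _ hs
    have e : ∑ t, ‖g t + τ • (h t - g t)‖ ^ 2 = A + 2 * τ * (B - A) + τ ^ 2 * C := by
      simp only [A, B, C, Finset.mul_sum, ← Finset.sum_add_distrib, ← Finset.sum_sub_distrib]
      refine Finset.sum_congr rfl fun t _ => ?_
      rw [norm_add_sq_real, inner_smul_right, norm_smul, inner_sub_right,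
        real_inner_self_eq_norm_sq, mul_pow, Real.norm_eq_abs, sq_abs]
      ring
    rw [e] at this
    linarith
  by_contra! hlt
  -- the quadratic in `τ` has negative slope at `0`; this `τ` makes it negative
  have hpos : 0 < A - B := by linarith
  have h0 : 0 < (A - B) / (C + (A - B)) := by positivity
  have h1 : (A - B) / (C + (A - B)) ≤ 1 := by rw [div_le_one (by positivity)]; linarith
  have := key _ h0.le h1
  set τ := (A - B) / (C + (A - B)) with hτ
  have e : τ * (C + (A - B)) = A - B := by rw [hτ]; field_simp
  nlinarith [mul_pos h0 h0, mul_pos h0 hpos, mul_pos (mul_pos h0 h0) hpos]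

lemma IsMinNormSubgradient.eq {P : Problem d p m} {β g h : Coef p m}
    (hg : P.IsMinNormSubgradient β g) (hh : P.IsMinNormSubgradient β h) : g = h := by
  have h₁ := hg.sum_sq_le_inner hh.1
  have h₂ := hh.2 g hg.1
  have e : ∑ t, ‖g t - h t‖ ^ 2 =
      ∑ t, ‖g t‖ ^ 2 - 2 * ∑ t, inner ℝ (g t) (h t) + ∑ t, ‖h t‖ ^ 2 := by
    simp only [Finset.mul_sum, ← Finset.sum_add_distrib, ← Finset.sum_sub_distrib]
    exact Finset.sum_congr rfl fun t _ => norm_sub_sq_real _ _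
  have e0 : ∑ t, ‖g t - h t‖ ^ 2 = 0 :=
    le_antisymm (by linarith) (Finset.sum_nonneg fun t _ => sq_nonneg _)
  rw [Finset.sum_eq_zero_iff_of_nonneg fun t _ => sq_nonneg _] at e0
  funext t
  simpa [sub_eq_zero] using e0 t (Finset.mem_univ t)

/-- If `F` does not decrease along the ray `β - a g`, the ray at height `F β` can be separated from
the strict epigraph of `F`, and the separating hyperplane is the graph of a subgradient. -/
lemma exists_isSubgradient_inner_nonpos (P : Problem d p m) {β g : Coef p m}
    (h : ∀ a : ℝ, 0 ≤ a → P.F β ≤ P.F (β - a • g)) :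
    ∃ s : Coef p m, P.IsSubgradient β s ∧ ∑ t, inner ℝ (g t) (s t) ≤ 0 := by
  obtain ⟨f, u, hf₁, hf₂⟩ := geometric_hahn_banach_open
    (s := {q : Coef p m × ℝ | q.1 ∈ Set.univ ∧ P.F q.1 < q.2})
    (t := (fun a : ℝ => (β - a • g, P.F β)) '' Set.Ici 0)
    P.convexOn_F.convex_strict_epigraph
    (by simpa using isOpen_lt (P.continuous_F.comp continuous_fst) continuous_snd)
    (by
      rintro _ ⟨a, ha, rfl⟩ _ ⟨b, hb, rfl⟩ r s hr hs hrs
      refine ⟨r * a + s * b, by simp at ha hb ⊢; positivity, ?_⟩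
      obtain rfl : s = 1 - r := by linarith
      refine Prod.ext ?_ ?_
      · simp only [Prod.fst_add, Prod.smul_fst]; module
      · simp only [Prod.snd_add, Prod.smul_snd, smul_eq_mul]; ring)
    (by
      rw [Set.disjoint_left]
      rintro _ ⟨-, h₁⟩ ⟨a, ha, rfl⟩
      exact absurd h₁ (not_lt.2 (h a ha)))
  set l : Coef p m →L[ℝ] ℝ := f.comp (ContinuousLinearMap.inl ℝ _ _) with hl
  set c : ℝ := f (0, 1) with hc
  have hf : ∀ γ r, f (γ, r) = l γ + r * c := by
    intro γ r
    have : ((γ, r) : Coef p m × ℝ) = (γ, 0) + r • (0, 1) := by simp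
    rw [this, map_add, map_smul]; simp [hl, hc]
  have main : ∀ γ (a : ℝ), 0 ≤ a → l γ + P.F γ * c ≤ l β - a * l g + P.F β * c := by
    intro γ a ha
    have h₂ := hf₂ _ ⟨a, ha, rfl⟩
    rw [hf, map_sub, map_smul, smul_eq_mul] at h₂
    have h₁ : ∀ δ : ℝ, 0 < δ → l γ + (P.F γ + δ) * c ≤ u := fun δ hδ => by
      rw [← hf]; exact (hf₁ _ ⟨trivial, by simpa using hδ⟩).le
    have hlim : Filter.Tendsto (fun δ : ℝ => l γ + (P.F γ + δ) * c) (nhdsWithin 0 (Set.Ioi 0))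
        (nhds (l γ + (P.F γ + 0) * c)) :=
      ((by fun_prop : Continuous fun δ : ℝ => l γ + (P.F γ + δ) * c).tendsto 0).mono_left
        nhdsWithin_le_nhds
    have := le_of_tendsto hlim (by filter_upwards [self_mem_nhdsWithin] with δ hδ using h₁ δ hδ)
    rw [add_zero] at this
    exact this.trans h₂
  have hc0 : c < 0 := by
    have h₁ := hf₁ (β, P.F β + 1) ⟨trivial, by simp⟩
    have h₂ := hf₂ _ ⟨0, by simp, rfl⟩
    simp only [hf, zero_smul, sub_zero] at h₁ h₂
    linarith
  set s : Coef p m := fun t => (InnerProductSpace.toDual ℝ (EuclideanSpace ℝ (Fin p))).symm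
    ((-c)⁻¹ • l.comp (ContinuousLinearMap.single ℝ _ t)) with hs
  have hsl : ∀ v : Coef p m, ∑ t, inner ℝ (s t) (v t) = (-c)⁻¹ * l v := by
    intro v
    conv_rhs => rw [← Finset.univ_sum_single v, map_sum, Finset.mul_sum]
    refine Finset.sum_congr rfl fun t _ => ?_
    rw [hs, InnerProductSpace.toDual_symm_apply]
    rfl
  refine ⟨s, fun γ => ?_, ?_⟩
  · have h₁ := main γ 0 le_rfl
    have h₂ := hsl (γ - β)
    simp only [Pi.sub_apply, map_sub] at h₂
    rw [h₂, ← sub_nonneg]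
    have : P.F γ - (P.F β + (-c)⁻¹ * (l γ - l β)) =
        (-c)⁻¹ * (l β - 0 * l g + P.F β * c - (l γ + P.F γ * c)) := by
      field_simp [hc0.ne]; ring
    rw [this]
    exact mul_nonneg (inv_nonneg.2 (by linarith)) (by linarith)
  · have h₁ := main β 1 zero_le_one
    have h₂ := hsl g
    simp only [real_inner_comm] at h₂ ⊢
    rw [h₂]
    exact mul_nonpos_of_nonneg_of_nonpos (inv_nonneg.2 (by linarith)) (by linarith)

/-- The negative of a nonzero subgradient of minimal norm is a descent direction. -/
lemma IsExactStep.lt {P : Problem d p m} {β g : Coef p m} {a : ℝ} (ha : P.IsExactStep β g a)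
    (hg : P.IsMinNormSubgradient β g) (h0 : g ≠ 0) : P.F (β - a • g) < P.F β := by
  by_contra! hle
  obtain ⟨s, hs, hgs⟩ := P.exists_isSubgradient_inner_nonpos (β := β) (g := g) (by
    intro b hb
    rcases hb.eq_or_lt with rfl | hb
    · simp
    · exact hle.trans (ha.2 b hb))
  apply h0
  have h₁ := hg.sum_sq_le_inner hs
  have e0 : ∑ t, ‖g t‖ ^ 2 = 0 :=
    le_antisymm (by linarith) (Finset.sum_nonneg fun t _ => sq_nonneg _)
  rw [Finset.sum_eq_zero_iff_of_nonneg fun t _ => sq_nonneg _] at e0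
  funext t
  simpa using e0 t (Finset.mem_univ t)

lemma IsExactStep.F_eq {P : Problem d p m} {β g : Coef p m} {a b : ℝ} (ha : P.IsExactStep β g a)
    (hb : P.IsExactStep β g b) : P.F (β - a • g) = P.F (β - b • g) :=
  le_antisymm (ha.2 b hb.1) (hb.2 a ha.1)

lemma IsMinNormSubgradient.isGlobalMin {P : Problem d p m} {β : Coef p m}
    (h : P.IsMinNormSubgradient β 0) : P.IsGlobalMin β := fun γ => by
  simpa using h.1 γ

end Problem

/-! ### Descent and fusion cycles as sequences of fills -/

/-- Either nothing changes, or the blocks of an interval get an optimal common value and `F` does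
not increase. Every step of a block descent and of a fusion cycle is such a move. -/
def Problem.FillMove (P : Problem d p m) (β β' : Coef p m) : Prop :=
  β' = β ∨ ∃ a b x, a ≤ b ∧ P.IsBestFill β a b x ∧ β' = fill β a b x ∧ P.F β' ≤ P.F β

lemma fill_self (β : Coef p m) (t : Fin (m + 1)) (x : EuclideanSpace ℝ (Fin p)) :
    fill β t t x = Function.update β t x := by
  funext s
  by_cases h : s = t
  · subst h; simp [fill]
  · have : ¬ (t ≤ s ∧ s ≤ t) := fun hs => h (le_antisymm hs.2 hs.1)
    simp [fill, h, this]

lemma fill_congr {β : Coef p m} {S : Set (Fin m)}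
    (hβ : ∀ t ∉ S, β t.castSucc = β t.succ) {a b : Fin (m + 1)}
    (hS : ∀ t : Fin m, a ≤ t.castSucc → t.succ ≤ b → t ∉ S) :
    ∀ s, a ≤ s → s ≤ b → β s = β a := by
  intro s
  induction s using Fin.induction with
  | zero => intro h _; rw [Fin.le_zero_iff.1 h]
  | succ i ih =>
    intro h₁ h₂
    rcases h₁.eq_or_lt with h | h
    · rw [h]
    · have h' : a ≤ i.castSucc := Fin.le_castSucc_iff.2 h
      rw [← hβ i (hS i h' h₂)]
      exact ih h' (i.castSucc_lt_succ.le.trans h₂)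

/-- The cuts `S` that a fusion cycle keeps record of contain all the cuts of the coefficients, so
that chains are intervals of constancy. -/
lemma Problem.FusionStep.fillMove {P : Problem d p m} {t : Fin (m + 1)}
    {q q' : Coef p m × Set (Fin m)} (h : P.FusionStep t q q')
    (hq : ∀ t ∉ q.2, q.1 t.castSucc = q.1 t.succ) :
    P.FillMove q.1 q'.1 ∧ ∀ t ∉ q'.2, q'.1 t.castSucc = q'.1 t.succ := by
  cases h with
  | @chain β S b x hc hb hx =>
    refine ⟨.inr ⟨t, b, x, hc.le, hx, rfl, ?_⟩, fun s hs => ?_⟩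
    · have e : fill β t b (β t) = β := by
        funext s
        simp only [fill]
        split_ifs with h
        · exact (fill_congr hq hc.inside s h.1 h.2).symm
        · rfl
      simpa [e] using hx (β t)
    · have h₁ := hq s hs
      have h₂ : t ≤ s.castSucc ∧ s.castSucc ≤ b ↔ t ≤ s.succ ∧ s.succ ≤ b := by
        have l₁ : s.succ ≠ t := fun h => hs (hc.first s h)
        have l₂ : s.castSucc ≠ b := fun h => hs (hc.last s h)
        simp only [Fin.le_def, Ne, Fin.ext_iff, Fin.val_castSucc, Fin.val_succ] at *
        omega
      simp only [fill, h₂]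
      split_ifs
      · rfl
      · exact h₁
  | @merge β S a b c x ht ha hb hx hlt =>
    refine ⟨.inr ⟨a, b, x, ?_, hx, rfl, hlt.le⟩, fun s hs => ?_⟩
    · exact ha.le.trans (c.castSucc_lt_succ.le.trans hb.le)
    · have l₀ := ha.le
      have l₀' := hb.le
      have h₂ : a ≤ s.castSucc ∧ s.castSucc ≤ b ↔ a ≤ s.succ ∧ s.succ ≤ b := by
        by_cases hsc : s = c
        · subst hsc
          simp only [Fin.le_def, Fin.val_castSucc, Fin.val_succ] at *
          omega
        · have hs' : s ∉ S := fun h => hs ⟨h, hsc⟩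
          have l₁ : s.succ ≠ a := fun h => hs' (ha.first s h)
          have l₂ : s.castSucc ≠ b := fun h => hs' (hb.last s h)
          simp only [Fin.le_def, Ne, Fin.ext_iff, Fin.val_castSucc, Fin.val_succ] at *
          omega
      simp only [fill, h₂]
      split_ifs with hif
      · rfl
      · refine hq s fun h => hs ⟨h, ?_⟩
        rintro rfl
        apply hif
        simp only [Fin.le_def, Fin.val_castSucc, Fin.val_succ] at *
        omega
  | reject => exact ⟨.inl rfl, hq⟩
  | skip => exact ⟨.inl rfl, hq⟩

lemma Problem.BlockDescent.sweep {P : Problem d p m} {β β' : Coef p m}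
    (h : P.BlockDescent β β') :
    ∃ l : List (Fin (m + 1)), l.length = m + 1 ∧ Sweep (fun _ => P.FillMove) l β β' := by
  obtain ⟨l, hl, hs⟩ := h
  refine ⟨l, hl, ?_⟩
  clear hl
  induction hs with
  | nil => exact .nil _
  | @cons t l s s' s'' hstep _ ih =>
    refine .cons ?_ ih
    obtain ⟨x, hx, rfl⟩ := hstep
    refine .inr ⟨t, t, x, le_rfl, fun z => ?_, (fill_self _ _ _).symm, ?_⟩
    · simpa only [fill_self] using hx z
    · simpa using hx (s t)

lemma Problem.FusionCycle.sweep {P : Problem d p m} {β β' : Coef p m}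
    (h : P.FusionCycle β β') :
    ∃ l : List (Fin (m + 1)), l.length = m + 1 ∧ Sweep (fun _ => P.FillMove) l β β' := by
  obtain ⟨l, S', hl, hs⟩ := h
  refine ⟨l, hl, ?_⟩
  clear hl
  suffices ∀ q q' : Coef p m × Set (Fin m), Sweep P.FusionStep l q q' →
      (∀ t ∉ q.2, q.1 t.castSucc = q.1 t.succ) → Sweep (fun _ => P.FillMove) l q.1 q'.1 from
    this _ _ hs fun t ht => by simpa [cuts] using ht
  clear hs
  intro q q' hs
  induction hs with
  | nil => exact fun _ => .nil _
  | cons hstep _ ih => exact fun hq => .cons (hstep.fillMove hq).1 (ih (hstep.fillMove hq).2)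

lemma Problem.FillMove.F_le {P : Problem d p m} {β β' : Coef p m} (h : P.FillMove β β') :
    P.F β' ≤ P.F β := by
  rcases h with rfl | ⟨_, _, _, _, _, _, h⟩
  · exact le_rfl
  · exact h

lemma Sweep.F_le {P : Problem d p m} {l : List (Fin (m + 1))} {β β' : Coef p m}
    (h : Sweep (fun _ => P.FillMove) l β β') : P.F β' ≤ P.F β := by
  induction h with
  | nil => exact le_rfl
  | cons h _ ih => exact ih.trans h.F_le

/-! ### The third level -/

lemma Problem.AllChains.F_le {P : Problem d p m} {β β' : Coef p m} (h : P.AllChains β β') :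
    P.F β' ≤ P.F β := by
  induction h with
  | solve _ h => exact h _ fun _ ht => ht
  | merge _ _ h _ ih => exact ih.trans h

/-- The minimal values of `F` over the points with cuts in a prescribed set. -/
def Problem.chainValues (P : Problem d p m) : Set ℝ :=
  {v | ∃ S : Set (Fin m), IsLeast (P.F '' {γ | ∀ t ∉ S, γ t.castSucc = γ t.succ}) v}

lemma Problem.finite_chainValues (P : Problem d p m) : P.chainValues.Finite := by
  have : P.chainValues = ⋃ S : Set (Fin m),
      {v | IsLeast (P.F '' {γ | ∀ t ∉ S, γ t.castSucc = γ t.succ}) v} := by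
    ext v; simp [chainValues]
  rw [this]
  exact Set.finite_iUnion fun S => Set.Subsingleton.finite fun v hv v' hv' => hv.unique hv'

lemma Problem.AllChains.mem_chainValues {P : Problem d p m} {β β' : Coef p m}
    (h : P.AllChains β β') : P.F β' ∈ P.chainValues := by
  induction h with
  | @solve β β' h₁ h₂ =>
    refine ⟨cuts β, ⟨β', fun t ht => h₁ t (by simpa [cuts] using ht), rfl⟩, ?_⟩
    rintro _ ⟨γ, hγ, rfl⟩
    exact h₂ γ fun t ht => hγ t (by simpa [cuts] using ht)
  | merge _ _ _ _ ih => exact ih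

/-! ### Runs -/

lemma Problem.IsExactStep.F_le {P : Problem d p m} {β g : Coef p m} {a : ℝ}
    (ha : P.IsExactStep β g a) (hg : P.IsMinNormSubgradient β g) : P.F (β - a • g) ≤ P.F β := by
  by_cases h0 : g = 0
  · simp [h0]
  · exact (ha.lt hg h0).le

lemma Problem.AlgStep.F_le {P : Problem d p m} {ε : ℝ} {q q' : Phase × Coef p m}
    (h : P.AlgStep ε q q') : P.F q'.2 ≤ P.F q.2 := by
  cases h with
  | descent_again h => obtain ⟨l, -, h⟩ := h.sweep; exact h.F_le
  | descent_end h => obtain ⟨l, -, h⟩ := h.sweep; exact h.F_le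
  | fusion_again h => obtain ⟨l, -, h⟩ := h.sweep; exact h.F_le
  | fusion_back h => obtain ⟨l, -, h⟩ := h.sweep; exact h.F_le
  | fusion_end h => obtain ⟨l, -, h⟩ := h.sweep; exact h.F_le
  | allChains_nonzero h => exact h.F_le
  | allChains_again h => exact h.F_le
  | allChains_finished h => exact h.F_le
  | subgradient_again hg ha => exact ha.F_le hg
  | subgradient_stopped hg ha => exact ha.F_le hg

/-- Progress is only possible for tolerances below `1`, and is then a strict decrease. -/
lemma Problem.lt_of_progress {P : Problem d p m} {ε : ℝ} (hε : 0 < ε) {β β' : Coef p m}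
    (h : P.F β' < (1 - ε) * P.F β) : ε < 1 ∧ P.F β' < P.F β := by
  have h₀ := P.F_nonneg β
  have h₁ := P.F_nonneg β'
  constructor
  · by_contra! h'
    nlinarith
  · nlinarith

/-! ### Runs confined to block descent and fusion cycles -/

/-- The tail of a run that has left the third and fourth level for good. By the control flow, one of
any three consecutive iterations makes progress; `r` stands for `1 - ε`. -/
structure Problem.IsCycling (P : Problem d p m) (r : ℝ) (β : ℕ → Coef p m) : Prop where
  pos : 0 < r
  lt_one : r < 1
  sweep : ∀ n, ∃ l : List (Fin (m + 1)), l.length = m + 1 ∧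
    Sweep (fun _ => P.FillMove) l (β n) (β (n + 1))
  progress : ∀ n, P.F (β (n + 3)) < r * P.F (β n)

namespace Problem.IsCycling

variable {P : Problem d p m} {r : ℝ} {β : ℕ → Coef p m}

lemma antitone (h : P.IsCycling r β) : Antitone fun n => P.F (β n) :=
  antitone_nat_of_succ_le fun n => by obtain ⟨l, -, hl⟩ := h.sweep n; exact hl.F_le

lemma F_pos (h : P.IsCycling r β) (n : ℕ) : 0 < P.F (β n) := by
  have := h.progress n
  have h₁ := P.F_nonneg (β (n + 3))
  exact pos_of_mul_pos_right (h₁.trans_lt this) h.pos.le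

lemma strict (h : P.IsCycling r β) {n k : ℕ} (hk : n + 3 ≤ k) : P.F (β k) < P.F (β n) := by
  have h₁ := h.antitone hk
  have h₂ := h.progress n
  have h₃ := h.F_pos n
  have h₄ := h.lt_one
  simp only at h₁
  nlinarith

lemma summable (h : P.IsCycling r β) : Summable fun n => P.F (β n) := by
  refine summable_of_sum_range_le (c := 3 * P.F (β 0) / (1 - r)) (fun n => P.F_nonneg _) fun n => ?_
  have hr := h.lt_one
  rw [le_div_iff₀ (by linarith)]
  have h₁ : ∑ i ∈ Finset.range (n + 3), P.F (β i) ≤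
      3 * P.F (β 0) + r * ∑ i ∈ Finset.range n, P.F (β i) := by
    rw [Finset.sum_range_succ', Finset.sum_range_succ', Finset.sum_range_succ', Finset.mul_sum]
    have := Finset.sum_le_sum fun i (_ : i ∈ Finset.range n) => (h.progress i).le
    have e₁ := h.antitone (Nat.zero_le 1)
    have e₂ := h.antitone (Nat.zero_le 2)
    simp only [zero_add, Nat.reduceAdd, add_assoc] at e₁ e₂ this ⊢
    linarith
  have h₂ : ∑ i ∈ Finset.range n, P.F (β i) ≤ ∑ i ∈ Finset.range (n + 3), P.F (β i) :=
    Finset.sum_le_sum_of_subset_of_nonneg (Finset.range_mono (by omega))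
      fun i _ _ => P.F_nonneg _
  linarith

end Problem.IsCycling

/-! ### Convergence for a positive `ℓ₁` penalty -/

lemma Problem.norm_le_of_lam₁_pos (P : Problem d p m) (h : 0 < P.lam₁) (β : Coef p m)
    (t : Fin (m + 1)) : P.lam₁ * ‖β t‖ ≤ P.F β := by
  have h₁ : ‖β t‖ ≤ ∑ i, |β t i| := by
    conv_lhs => rw [← (EuclideanSpace.basisFun (Fin p) ℝ).sum_repr (β t)]
    refine (norm_sum_le _ _).trans (Finset.sum_le_sum fun i _ => ?_)
    simp [norm_smul]
  have h₂ : ∑ i, |β t i| ≤ ∑ t, ∑ i, |β t i| :=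
    Finset.single_le_sum (f := fun t => ∑ i, |β t i|)
      (fun t _ => Finset.sum_nonneg fun i _ => abs_nonneg _) (Finset.mem_univ t)
  have h₃ : 0 ≤ ∑ t : Fin m, P.w t * ‖β t.succ - β t.castSucc‖ :=
    Finset.sum_nonneg fun t _ => mul_nonneg (P.w_pos t).le (norm_nonneg _)
  have h₄ := mul_nonneg P.lam₂_nonneg h₃
  have h₅ := mul_le_mul_of_nonneg_left (h₁.trans h₂) h.le
  have h₆ : 0 ≤ ∑ t, ∑ i, (P.y t i - (P.X t).mulVec (β t).ofLp i) ^ 2 := by positivity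
  unfold F
  linarith

/-! ### Convergence for a positive fusion penalty -/

/-- When `F` is small, the blocks are close to each other. -/
lemma Problem.exists_dist_le (P : Problem d p m) (h : 0 < P.lam₂) :
    ∃ C, 0 ≤ C ∧ ∀ (β : Coef p m) (s t : Fin (m + 1)), ‖β s - β t‖ ≤ C * P.F β := by
  set D : ℝ := ∑ j, (P.lam₂ * P.w j)⁻¹ with hD
  have hw : ∀ j, 0 < P.lam₂ * P.w j := fun j => mul_pos h (P.w_pos j)
  have hD0 : 0 ≤ D := Finset.sum_nonneg fun j _ => (inv_pos.2 (hw j)).le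
  have h₁ : ∀ (β : Coef p m) (j : Fin m), ‖β j.succ - β j.castSucc‖ ≤ D * P.F β := by
    intro β j
    have e₁ : P.w j * ‖β j.succ - β j.castSucc‖ ≤
        ∑ t : Fin m, P.w t * ‖β t.succ - β t.castSucc‖ :=
      Finset.single_le_sum (f := fun t : Fin m => P.w t * ‖β t.succ - β t.castSucc‖)
        (fun t _ => mul_nonneg (P.w_pos t).le (norm_nonneg _)) (Finset.mem_univ j)
    have e₂ : 0 ≤ ∑ t, ∑ i, (P.y t i - (P.X t).mulVec (β t).ofLp i) ^ 2 := by positivity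
    have e₃ : 0 ≤ P.lam₁ * ∑ t, ∑ i, |β t i| := mul_nonneg P.lam₁_nonneg (by positivity)
    have e₄ : P.lam₂ * P.w j * ‖β j.succ - β j.castSucc‖ ≤ P.F β := by
      have := mul_le_mul_of_nonneg_left e₁ h.le
      unfold F
      linarith
    have e₅ : (P.lam₂ * P.w j)⁻¹ ≤ D :=
      Finset.single_le_sum (f := fun j => (P.lam₂ * P.w j)⁻¹)
        (fun t _ => (inv_pos.2 (hw t)).le) (Finset.mem_univ j)
    calc ‖β j.succ - β j.castSucc‖ ≤ (P.lam₂ * P.w j)⁻¹ * P.F β := by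
          rwa [le_inv_mul_iff₀ (hw j)]
      _ ≤ D * P.F β := mul_le_mul_of_nonneg_right e₅ (P.F_nonneg β)
  have h₂ : ∀ (β : Coef p m) (s : Fin (m + 1)), ‖β s - β 0‖ ≤ s.val * (D * P.F β) := by
    intro β s
    induction s using Fin.induction with
    | zero => simp
    | succ i ih =>
      have := norm_sub_le_norm_sub_add_norm_sub (β i.succ) (β i.castSucc) (β 0)
      have e := h₁ β i
      simp only [Fin.val_castSucc, Fin.val_succ] at ih ⊢
      push_cast
      linarith
  have h₃ : ∀ (β : Coef p m) (s : Fin (m + 1)), ‖β s - β 0‖ ≤ m * (D * P.F β) := fun β s =>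
    (h₂ β s).trans (mul_le_mul_of_nonneg_right (by exact_mod_cast Nat.lt_succ_iff.1 s.2)
      (mul_nonneg hD0 (P.F_nonneg β)))
  refine ⟨2 * m * D, by positivity, fun β s t => ?_⟩
  have := norm_sub_le_norm_sub_add_norm_sub (β s) (β 0) (β t)
  have e₁ := h₃ β s
  have e₂ := h₃ β t
  rw [norm_sub_rev] at e₂
  linarith

/-- A move that leaves some block unchanged is short when `F` is small; a move of all blocks brings
`F` to its minimum over constant coefficient sequences. -/
lemma Problem.FillMove.dist_le {P : Problem d p m} {C : ℝ} (hC : 0 ≤ C)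
    (h : ∀ (β : Coef p m) (s t : Fin (m + 1)), ‖β s - β t‖ ≤ C * P.F β) {β β' : Coef p m}
    (hm : P.FillMove β β') :
    (∃ v, IsLeast (Set.range fun x => P.F fun _ => x) v ∧ P.F β' ≤ v ∧ v ≤ P.F β) ∨
      dist β β' ≤ 2 * C * P.F β := by
  rcases hm with rfl | ⟨a, b, x, hab, hx, rfl, hF⟩
  · right
    rw [dist_self]
    exact mul_nonneg (by positivity) (P.F_nonneg _)
  by_cases hfull : ∀ s, a ≤ s ∧ s ≤ b
  · left
    have e : ∀ z, fill β a b z = fun _ => z := fun z => by funext s; simp [fill, hfull s]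
    refine ⟨_, ⟨⟨x, rfl⟩, ?_⟩, ?_, ?_⟩
    · rintro _ ⟨z, rfl⟩
      simpa only [e] using hx z
    · rw [e]
    · rwa [e] at hF
  · right
    obtain ⟨r, hr⟩ := not_forall.1 hfull
    have hr' : fill β a b x r = β r := if_neg hr
    have h0 : 0 ≤ C * P.F β := mul_nonneg hC (P.F_nonneg _)
    refine (dist_pi_le_iff (by linarith)).2 fun s => ?_
    have e₁ := h (fill β a b x) r s
    have e₂ := h β s r
    have e₃ := mul_le_mul_of_nonneg_left hF hC
    rw [hr'] at e₁
    rw [dist_eq_norm]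
    have := norm_sub_le_norm_sub_add_norm_sub (β s) (β r) (fill β a b x s)
    linarith

lemma Sweep.dist_le {P : Problem d p m} {C : ℝ} (hC : 0 ≤ C)
    (h : ∀ (β : Coef p m) (s t : Fin (m + 1)), ‖β s - β t‖ ≤ C * P.F β)
    {l : List (Fin (m + 1))} {β β' : Coef p m} (hs : Sweep (fun _ => P.FillMove) l β β') :
    (∃ v, IsLeast (Set.range fun x => P.F fun _ => x) v ∧ P.F β' ≤ v ∧ v ≤ P.F β) ∨
      dist β β' ≤ l.length * (2 * C * P.F β) := by
  induction hs with
  | nil => right; simp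
  | @cons t l s s' s'' hm hs ih =>
    have h₁ := hm.F_le
    have h₂ := Sweep.F_le hs
    rcases ih with ⟨v, hv, hv₁, hv₂⟩ | ih
    · exact .inl ⟨v, hv, hv₁, hv₂.trans h₁⟩
    rcases hm.dist_le hC h with ⟨v, hv, hv₁, hv₂⟩ | hd
    · exact .inl ⟨v, hv, h₂.trans hv₁, hv₂⟩
    right
    have := dist_triangle s s' s''
    have h₃ : (l.length : ℝ) * (2 * C * P.F s') ≤ l.length * (2 * C * P.F s) := by gcongr
    rw [List.length_cons]
    push_cast
    linarith

lemma Problem.IsCycling.cauchySeq {P : Problem d p m} {r : ℝ} {β : ℕ → Coef p m}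
    (h : P.IsCycling r β) (hl : 0 < P.lam₂) : CauchySeq β := by
  obtain ⟨C, hC, hd⟩ := P.exists_dist_le hl
  have hstep : ∀ n, (∃ v, IsLeast (Set.range fun x => P.F fun _ => x) v ∧
      P.F (β (n + 1)) ≤ v ∧ v ≤ P.F (β n)) ∨
      dist (β n) (β (n + 1)) ≤ ((m + 1 : ℕ) : ℝ) * (2 * C * P.F (β n)) := by
    intro n
    obtain ⟨l, hl, hs⟩ := h.sweep n
    have := hs.dist_le hC hd
    rwa [hl] at this
  -- after a move of all blocks, the next progress makes another such move impossible
  have hev : ∃ N, ∀ n, N ≤ n →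
      dist (β n) (β (n + 1)) ≤ ((m + 1 : ℕ) : ℝ) * (2 * C * P.F (β n)) := by
    by_cases hv : ∃ n, ∃ v, IsLeast (Set.range fun x => P.F fun _ => x) v ∧
        P.F (β (n + 1)) ≤ v ∧ v ≤ P.F (β n)
    · obtain ⟨n, v, hv, hv₁, -⟩ := hv
      refine ⟨n + 4, fun k hk => (hstep k).resolve_left ?_⟩
      rintro ⟨v', hv', -, hv₂⟩
      have := h.strict (n := n + 1) (k := k) (by omega)
      rw [hv'.unique hv] at hv₂
      linarith
    · exact ⟨0, fun k _ => (hstep k).resolve_left fun hk => hv ⟨k, hk⟩⟩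
  obtain ⟨N, hN⟩ := hev
  rw [← cauchySeq_shift N]
  refine cauchySeq_of_summable_dist ?_
  refine Summable.of_nonneg_of_le (fun _ => dist_nonneg) (fun n => ?_)
    ((((summable_nat_add_iff N).2 h.summable).mul_left (2 * C)).mul_left ((m + 1 : ℕ) : ℝ))
  have := hN (n + N) (by omega)
  rwa [show n + 1 + N = n + N + 1 by omega]

/-! ### Unpenalized problems -/

lemma Problem.F_eq_sum_loss (P : Problem d p m) (h₁ : P.lam₁ = 0) (h₂ : P.lam₂ = 0)
    (β : Coef p m) : P.F β = ∑ t, P.loss t (β t) := by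
  simp [F, loss, h₁, h₂, Finset.mul_sum]

/-- Without penalties, the losses of the blocks in an interval after an optimal fill do not depend
on the current coefficients or on the choice of the minimizer, since the fitted values are unique. -/
lemma Problem.loss_eq_of_isBestFill (P : Problem d p m) (h₁ : P.lam₁ = 0) (h₂ : P.lam₂ = 0)
    {β β' : Coef p m} {a b : Fin (m + 1)} {x x' : EuclideanSpace ℝ (Fin p)}
    (hx : P.IsBestFill β a b x) (hx' : P.IsBestFill β' a b x') {t : Fin (m + 1)}
    (ht : a ≤ t ∧ t ≤ b) : P.loss t x = P.loss t x' := by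
  set I := Finset.univ.filter fun t : Fin (m + 1) => a ≤ t ∧ t ≤ b with hI
  have hfill : ∀ (β : Coef p m) z, P.F (fill β a b z) =
      ∑ t ∈ I, P.loss t z + ∑ t ∈ Finset.univ.filter (fun t => ¬ (a ≤ t ∧ t ≤ b)),
        P.loss t (β t) := by
    intro β z
    rw [P.F_eq_sum_loss h₁ h₂, ← Finset.sum_filter_add_sum_filter_not _ (fun t => a ≤ t ∧ t ≤ b)]
    congr 1 <;> refine Finset.sum_congr rfl fun t ht => ?_
    · rw [fill, if_pos (Finset.mem_filter.1 ht).2]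
    · rw [fill, if_neg (Finset.mem_filter.1 ht).2]
  have hmin : ∀ z, ∑ t ∈ I, P.loss t x ≤ ∑ t ∈ I, P.loss t z := fun z => by
    have := hx z
    rw [hfill, hfill] at this
    linarith
  have hmin' : ∀ z, ∑ t ∈ I, P.loss t x' ≤ ∑ t ∈ I, P.loss t z := fun z => by
    have := hx' z
    rw [hfill, hfill] at this
    linarith
  -- parallelogram identity at the midpoint
  have hpar : ∀ t, P.loss t ((1 / 2 : ℝ) • (x + x')) = 1 / 2 * P.loss t x + 1 / 2 * P.loss t x' -
      1 / 8 * ∑ i, ((P.X t).mulVec x.ofLp i - (P.X t).mulVec x'.ofLp i) ^ 2 := by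
    intro t
    have e : ∀ i, (P.X t).mulVec ((1 / 2 : ℝ) • (x + x')).ofLp i =
        1 / 2 * ((P.X t).mulVec x.ofLp i + (P.X t).mulVec x'.ofLp i) := by
      intro i
      simp [Matrix.mulVec_add, Matrix.mulVec_smul, mul_add]
    simp only [loss, e, Finset.mul_sum, ← Finset.sum_add_distrib, ← Finset.sum_sub_distrib]
    exact Finset.sum_congr rfl fun i _ => by ring
  have hmid := hmin ((1 / 2 : ℝ) • (x + x'))
  have hxx' := hmin' x
  have hsum : ∑ t ∈ I, P.loss t ((1 / 2 : ℝ) • (x + x')) =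
      1 / 2 * ∑ t ∈ I, P.loss t x + 1 / 2 * ∑ t ∈ I, P.loss t x' - 1 / 8 *
        ∑ t ∈ I, ∑ i, ((P.X t).mulVec x.ofLp i - (P.X t).mulVec x'.ofLp i) ^ 2 := by
    rw [Finset.sum_congr rfl fun t _ => hpar t]
    simp only [Finset.sum_sub_distrib, Finset.sum_add_distrib, Finset.mul_sum]
  have hzero : ∑ t ∈ I, ∑ i, ((P.X t).mulVec x.ofLp i - (P.X t).mulVec x'.ofLp i) ^ 2 = 0 :=
    le_antisymm (by linarith) (Finset.sum_nonneg fun t _ => Finset.sum_nonneg fun i _ => sq_nonneg _)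
  rw [Finset.sum_eq_zero_iff_of_nonneg
    fun t _ => Finset.sum_nonneg fun i _ => sq_nonneg _] at hzero
  have hz := hzero t (by simp [hI, ht])
  rw [Finset.sum_eq_zero_iff_of_nonneg fun i _ => sq_nonneg _] at hz
  simp only [loss]
  congr 1
  refine Finset.sum_congr rfl fun i hi => ?_
  have := hz i hi
  rw [pow_eq_zero_iff two_ne_zero, sub_eq_zero] at this
  rw [this]

/-- Without penalties only finitely many values of `F` could be met, against the infinitely many
strict decreases. -/
lemma Problem.IsCycling.penalized {P : Problem d p m} {r : ℝ} {β : ℕ → Coef p m}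
    (h : P.IsCycling r β) : 0 < P.lam₁ ∨ 0 < P.lam₂ := by
  by_contra! hl
  have h₁ : P.lam₁ = 0 := le_antisymm hl.1 P.lam₁_nonneg
  have h₂ : P.lam₂ = 0 := le_antisymm hl.2 P.lam₂_nonneg
  set W : Fin (m + 1) → Set ℝ := fun t => ⋃ q : Fin (m + 1) × Fin (m + 1),
    {v | (q.1 ≤ t ∧ t ≤ q.2) ∧ ∃ γ x, P.IsBestFill γ q.1 q.2 x ∧ v = P.loss t x} with hW
  set V : Fin (m + 1) → Set ℝ := fun t => insert (P.loss t (β 0 t)) (W t) with hV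
  have hVfin : ∀ t, (V t).Finite := by
    intro t
    refine Set.Finite.insert _ (Set.finite_iUnion fun q => Set.Subsingleton.finite ?_)
    rintro _ ⟨hq, γ, x, hx, rfl⟩ _ ⟨-, γ', x', hx', rfl⟩
    exact P.loss_eq_of_isBestFill h₁ h₂ hx hx' hq
  have hmove : ∀ γ γ' : Coef p m, P.FillMove γ γ' → (∀ t, P.loss t (γ t) ∈ V t) →
      ∀ t, P.loss t (γ' t) ∈ V t := by
    rintro γ γ' (rfl | ⟨a, b, x, -, hx, rfl, -⟩) hγ t
    · exact hγ t
    · by_cases ht : a ≤ t ∧ t ≤ b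
      · rw [fill, if_pos ht]
        exact .inr (Set.mem_iUnion.2 ⟨(a, b), ht, γ, x, hx, rfl⟩)
      · rw [fill, if_neg ht]
        exact hγ t
  have hall : ∀ n t, P.loss t (β n t) ∈ V t := by
    intro n
    induction n with
    | zero => exact fun t => .inl rfl
    | succ n ih =>
      obtain ⟨l, -, hs⟩ := h.sweep n
      generalize β n = γ, β (n + 1) = γ' at ih hs
      clear_value V
      induction hs with
      | nil => exact ih
      | cons hm _ ih' => exact ih' (hmove _ _ hm ih)
  have hfin : ((fun v : Fin (m + 1) → ℝ => ∑ t, v t) '' Set.univ.pi V).Finite :=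
    (Set.Finite.pi' hVfin |>.subset (by intro v hv t; exact hv t trivial)).image _
  have hinj : Function.Injective fun n : ℕ => P.F (β (3 * n)) :=
    (strictAnti_nat_of_succ_lt fun n => h.strict (by omega)).injective
  refine Set.infinite_range_of_injective hinj (hfin.subset ?_)
  rintro _ ⟨n, rfl⟩
  exact ⟨fun t => P.loss t (β (3 * n) t), fun t _ => hall _ t, (P.F_eq_sum_loss h₁ h₂ _).symm⟩

/-- The limit of an infinite succession of cycles has `F = 0`. -/
lemma Problem.IsCycling.exists_tendsto {P : Problem d p m} {r : ℝ} {β : ℕ → Coef p m}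
    (h : P.IsCycling r β) :
    ∃ b, P.IsGlobalMin b ∧ Filter.Tendsto β Filter.atTop (nhds b) := by
  have hF := h.summable.tendsto_atTop_zero
  have hb : ∃ b, Filter.Tendsto β Filter.atTop (nhds b) := by
    rcases h.penalized with hl | hl
    · refine ⟨0, tendsto_pi_nhds.2 fun t => squeeze_zero_norm (fun n => ?_)
        (by simpa using hF.const_mul P.lam₁⁻¹)⟩
      rw [le_inv_mul_iff₀ hl]
      exact P.norm_le_of_lam₁_pos hl _ t
    · exact cauchySeq_tendsto_of_complete (h.cauchySeq hl)
  obtain ⟨b, hb⟩ := hb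
  refine ⟨b, fun γ => ?_, hb⟩
  rw [tendsto_nhds_unique ((P.continuous_F.tendsto b).comp hb) hF]
  exact P.F_nonneg γ

/-! ### The control flow of a run -/

namespace Problem.IsContinuedRun

variable {P : Problem d p m} {ε : ℕ → ℝ} {k : ℕ → ℕ} {ph : ℕ → Phase} {β : ℕ → Coef p m}

lemma antitone (h : P.IsContinuedRun ε k ph β) : Antitone fun n => P.F (β n) := by
  refine antitone_nat_of_succ_le fun n => ?_
  by_cases h₁ : ph n = .finished
  · rw [(h.halt n h₁).2.1]
  by_cases h₂ : ph n = .stopped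
  · rw [(h.restart n h₂).2.1]
  exact (h.step n h₁ h₂).1.F_le

lemma isGlobalMin_of_finished (h : P.IsContinuedRun ε k ph β) {n : ℕ} (hn : ph n = .finished) :
    P.IsGlobalMin (β n) := by
  induction n with
  | zero => simp [h.init.1] at hn
  | succ n ih =>
    by_cases h₁ : ph n = .finished
    · rw [(h.halt n h₁).2.1]
      exact ih h₁
    by_cases h₂ : ph n = .stopped
    · simp [(h.restart n h₂).1] at hn
    have hs := (h.step n h₁ h₂).1
    rw [hn] at hs
    generalize ph n = q at hs
    generalize β (n + 1) = x' at hs ⊢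
    cases hs with
    | allChains_finished _ hg _ => exact hg.isGlobalMin

lemma convergesToMin_of_finished (h : P.IsContinuedRun ε k ph β) {n : ℕ}
    (hn : ph n = .finished) : P.ConvergesToMin β := by
  have hc : ∀ i, ph (n + i) = .finished ∧ β (n + i) = β n := by
    intro i
    induction i with
    | zero => exact ⟨hn, rfl⟩
    | succ i ih =>
      have := h.halt _ ih.1
      exact ⟨this.1, this.2.1.trans ih.2⟩
  have ht : Filter.Tendsto β Filter.atTop (nhds (β n)) :=
    tendsto_const_nhds.congr' (by
      filter_upwards [Filter.eventually_ge_atTop n] with i hi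
      obtain ⟨j, rfl⟩ := Nat.exists_eq_add_of_le hi
      exact (hc j).2.symm)
  exact ⟨h.antitone, β n, h.isGlobalMin_of_finished hn, ht,
    (P.continuous_F.tendsto _).comp ht⟩

/-- What follows the third level in a run that does not finish: either a strict decrease by a
subgradient step, or a strict decrease at the third level itself. -/
lemma after_allChains (h : P.IsContinuedRun ε k ph β) (hε : ∀ k, 0 < ε k)
    (hf : ∀ n, ph n ≠ .finished) {n : ℕ} (hn : ph n = .allChains) :
    P.F (β (n + 1)) ∈ P.chainValues ∧
      ((ph (n + 1) = .subgradient ∧ P.F (β (n + 2)) < P.F (β (n + 1))) ∨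
        P.F (β (n + 1)) < P.F (β n)) := by
  have hs := (h.step n (hf n) (by simp [hn])).1
  have hf' := hf (n + 1)
  generalize hq' : ph (n + 1) = q' at hs hf' ⊢
  generalize hx' : β (n + 1) = x' at hs ⊢
  rw [hn] at hs
  cases hs with
  | @allChains_nonzero _ _ g hc hg h0 =>
    refine ⟨hc.mem_chainValues, .inl ⟨rfl, ?_⟩⟩
    have hs := (h.step (n + 1) (hf _) (by simp [hq'])).1
    generalize ph (n + 1 + 1) = r' at hs
    rw [show n + 2 = n + 1 + 1 from rfl]
    generalize β (n + 1 + 1) = z' at hs ⊢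
    rw [hq', hx'] at hs
    cases hs with
    | subgradient_again hg' ha _ => exact ha.lt hg' (hg.eq hg' ▸ h0)
    | subgradient_stopped hg' ha _ => exact ha.lt hg' (hg.eq hg' ▸ h0)
  | allChains_again hc hg hlt => exact ⟨hc.mem_chainValues, .inr (lt_of_progress (hε _) hlt).2⟩
  | allChains_finished => exact absurd rfl hf'

/-- The third level is visited finitely often: the values of `F` that it returns lie in a finite
set, and `F` strictly decreases between suitable visits. -/
lemma finite_allChains (h : P.IsContinuedRun ε k ph β) (hε : ∀ k, 0 < ε k)
    (hf : ∀ n, ph n ≠ .finished) : {n | ph n = .allChains}.Finite := by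
  set A : Set ℕ := {n | ph n = .allChains ∧ P.F (β (n + 2)) < P.F (β (n + 1)) ∧
    ph (n + 1) = .subgradient}
  set B : Set ℕ := {n | ph n = .allChains ∧ P.F (β (n + 1)) < P.F (β n)}
  have hmaps : ∀ n, ph n = .allChains → P.F (β (n + 1)) ∈ P.chainValues := fun n hn =>
    (h.after_allChains hε hf hn).1
  have hA : A.Finite := by
    refine Set.Finite.of_injOn (f := fun n => P.F (β (n + 1))) (fun n hn => hmaps n hn.1) ?_
      P.finite_chainValues
    have key : ∀ i ∈ A, ∀ j ∈ A, i < j → P.F (β (j + 1)) < P.F (β (i + 1)) := by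
      intro i hi j hj hij
      have hne : j ≠ i + 1 := by
        rintro rfl
        have := hj.1.symm.trans hi.2.2
        simp at this
      exact (h.antitone (show i + 2 ≤ j + 1 by omega)).trans_lt hi.2.1
    intro i hi j hj hij
    rcases lt_trichotomy i j with hlt | heq | hlt
    · exact absurd hij (key i hi j hj hlt).ne'
    · exact heq
    · exact absurd hij (key j hj i hi hlt).ne
  have hB : B.Finite := by
    refine Set.Finite.of_injOn (f := fun n => P.F (β (n + 1))) (fun n hn => hmaps n hn.1) ?_
      P.finite_chainValues
    have key : ∀ i ∈ B, ∀ j ∈ B, i < j → P.F (β (j + 1)) < P.F (β (i + 1)) :=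
      fun i _ j hj hij => hj.2.trans_le (h.antitone (show i + 1 ≤ j from hij))
    intro i hi j hj hij
    rcases lt_trichotomy i j with hlt | heq | hlt
    · exact absurd hij (key i hi j hj hlt).ne'
    · exact heq
    · exact absurd hij (key j hj i hi hlt).ne
  refine (hA.union hB).subset fun n hn => ?_
  rcases (h.after_allChains hε hf hn).2 with h' | h'
  · exact .inl ⟨hn, h'.2, h'.1⟩
  · exact .inr ⟨hn, h'⟩

lemma allChains_of_subgradient (h : P.IsContinuedRun ε k ph β) {n : ℕ}
    (hn : ph (n + 1) = .subgradient) : ph n = .allChains := by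
  by_cases h₁ : ph n = .finished
  · simp [(h.halt n h₁).1] at hn
  by_cases h₂ : ph n = .stopped
  · simp [(h.restart n h₂).1] at hn
  have hs := (h.step n h₁ h₂).1
  rw [hn] at hs
  generalize ph n = q at hs ⊢
  cases hs
  rfl

lemma subgradient_of_stopped (h : P.IsContinuedRun ε k ph β) {n : ℕ}
    (hn : ph (n + 1) = .stopped) : ph n = .subgradient := by
  by_cases h₁ : ph n = .finished
  · simp [(h.halt n h₁).1] at hn
  by_cases h₂ : ph n = .stopped
  · simp [(h.restart n h₂).1] at hn
  have hs := (h.step n h₁ h₂).1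
  rw [hn] at hs
  generalize ph n = q at hs ⊢
  generalize β n = x, β (n + 1) = x' at hs
  cases hs
  rfl

/-- One iteration of the first two levels that does not lead to the third. The possible phases and
the presence of progress are recorded. -/
lemma cycle_step {e : ℝ} {q q' : Phase} {x x' : Coef p m} (h : P.AlgStep e (q, x) (q', x'))
    (hq : q = .descent ∨ ∃ b, q = .fusion b) (hq' : q' ≠ .allChains) :
    (∃ l : List (Fin (m + 1)), l.length = m + 1 ∧ Sweep (fun _ => P.FillMove) l x x') ∧
      (P.F x' < (1 - e) * P.F x ∨ (q = .descent ∧ q' = .fusion false) ∨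
        (q = .fusion true ∧ q' = .descent)) := by
  cases h with
  | descent_again h hp => exact ⟨h.sweep, .inl hp⟩
  | descent_end h _ => exact ⟨h.sweep, .inr (.inl ⟨rfl, rfl⟩)⟩
  | fusion_again h hp => exact ⟨h.sweep, .inl hp⟩
  | fusion_back h _ => exact ⟨h.sweep, .inr (.inr ⟨rfl, rfl⟩)⟩
  | fusion_end h _ => exact absurd rfl hq'
  | _ => simp at hq

lemma exists_isCycling (h : P.IsContinuedRun ε k ph β) (hε : ∀ k, 0 < ε k)
    (hf : ∀ n, ph n ≠ .finished) : ∃ N r, P.IsCycling r fun n => β (N + n) := by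
  obtain ⟨N₀, hN₀⟩ := (h.finite_allChains hε hf).bddAbove
  have hA : ∀ n, N₀ < n → ph n ≠ .allChains := fun n hn h' => absurd (hN₀ h') (not_le.2 hn)
  have hG : ∀ n, N₀ + 1 < n → ph n ≠ .subgradient := fun n hn h' => by
    obtain ⟨n, rfl⟩ := Nat.exists_eq_succ_of_ne_zero (show n ≠ 0 by omega)
    exact hA n (by omega) (h.allChains_of_subgradient h')
  have hS : ∀ n, N₀ + 2 < n → ph n ≠ .stopped := fun n hn h' => by
    obtain ⟨n, rfl⟩ := Nat.exists_eq_succ_of_ne_zero (show n ≠ 0 by omega)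
    exact hG n (by omega) (h.subgradient_of_stopped h')
  set N := N₀ + 3 with hN
  have hph : ∀ n, ph (N + n) = .descent ∨ ∃ b, ph (N + n) = .fusion b := by
    intro n
    have h₁ := hA (N + n) (by omega)
    have h₂ := hG (N + n) (by omega)
    have h₃ := hS (N + n) (by omega)
    have h₄ := hf (N + n)
    generalize ph (N + n) = q at *
    cases q <;> simp_all
  have hstep : ∀ n, P.AlgStep (ε (k (N + n))) (ph (N + n), β (N + n))
      (ph (N + n + 1), β (N + n + 1)) ∧ k (N + n + 1) = k (N + n) := fun n =>
    h.step _ (hf _) (hS _ (by omega))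
  have hk : ∀ n, k (N + n) = k N := by
    intro n
    induction n with
    | zero => rfl
    | succ n ih => exact (hstep n).2.trans ih
  have hcyc := fun n => cycle_step (hk n ▸ (hstep n).1) (hph n) (hA _ (by omega))
  set e := ε (k N) with he
  have he0 : 0 < e := hε _
  have hmono : ∀ n, P.F (β (N + n + 1)) ≤ P.F (β (N + n)) := fun n => h.antitone (Nat.le_succ _)
  -- without progress the phases run through `fusion true`, `descent`, `fusion false`, and the next
  -- cycle without progress would lead to the third level
  have hprog : ∀ n, P.F (β (N + n + 1)) < (1 - e) * P.F (β (N + n)) ∨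
      P.F (β (N + n + 2)) < (1 - e) * P.F (β (N + n + 1)) ∨
      P.F (β (N + n + 3)) < (1 - e) * P.F (β (N + n + 2)) := by
    intro n
    have c₁ := (hcyc n).2
    have c₂ := (hcyc (n + 1)).2
    have c₃ := (hcyc (n + 2)).2
    simp only [← add_assoc] at c₂ c₃
    rcases c₁ with c₁ | ⟨a₁, b₁⟩ | ⟨a₁, b₁⟩
    · exact .inl c₁
    · rcases c₂ with c₂ | ⟨a₂, -⟩ | ⟨a₂, -⟩
      · exact .inr (.inl c₂)
      · simp [b₁] at a₂
      · simp [b₁] at a₂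
    · rcases c₂ with c₂ | ⟨a₂, b₂⟩ | ⟨a₂, -⟩
      · exact .inr (.inl c₂)
      · rcases c₃ with c₃ | ⟨a₃, -⟩ | ⟨a₃, -⟩
        · exact .inr (.inr c₃)
        · simp [b₂] at a₃
        · simp [b₂] at a₃
      · simp [b₁] at a₂
  have he1 : e < 1 := by
    rcases hprog 0 with hp | hp | hp <;> exact (lt_of_progress he0 hp).1
  refine ⟨N, 1 - e, by linarith, by linarith, fun n => (hcyc n).1, fun n => ?_⟩
  have m₁ := hmono n
  have m₂ := hmono (n + 1)
  have m₃ := hmono (n + 2)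
  have hr : 0 ≤ 1 - e := by linarith
  simp only [← add_assoc] at m₁ m₂ m₃ ⊢
  rcases hprog n with hp | hp | hp
  · exact (m₃.trans m₂).trans_lt hp
  · exact m₃.trans_lt (hp.trans_le (mul_le_mul_of_nonneg_left m₁ hr))
  · exact hp.trans_le (mul_le_mul_of_nonneg_left (m₂.trans m₁) hr)

lemma convergesToMin (h : P.IsContinuedRun ε k ph β) (hε : ∀ k, 0 < ε k) :
    P.ConvergesToMin β := by
  by_cases hf : ∃ n, ph n = .finished
  · obtain ⟨n, hn⟩ := hf
    exact h.convergesToMin_of_finished hn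
  · push Not at hf
    obtain ⟨N, r, hc⟩ := h.exists_isCycling hε hf
    obtain ⟨b, hb, ht⟩ := hc.exists_tendsto
    have ht' : Filter.Tendsto β Filter.atTop (nhds b) := by
      rw [← Filter.tendsto_add_atTop_iff_nat N]
      simpa only [add_comm] using ht
    exact ⟨h.antitone, b, hb, ht', (P.continuous_F.tendsto _).comp ht'⟩

end Problem.IsContinuedRun

/-! ### Small fixed tolerances -/

/-- The subgradient of minimal norm and the value of the exact line search are unique, so that a
subgradient step from `β` has a definite positive relative decrease. -/
lemma Problem.exists_progress_tolerance (P : Problem d p m) (β : Coef p m) :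
    ∃ δ : ℝ, 0 < δ ∧ ∀ (g : Coef p m) (a : ℝ), P.IsMinNormSubgradient β g → g ≠ 0 →
      P.IsExactStep β g a → ∀ ε < δ, P.F (β - a • g) < (1 - ε) * P.F β := by
  by_cases hex : ∃ (g : Coef p m) (a : ℝ), P.IsMinNormSubgradient β g ∧ g ≠ 0 ∧
      P.IsExactStep β g a
  · obtain ⟨g, a, hg, h0, ha⟩ := hex
    have hlt := ha.lt hg h0
    have hpos : 0 < P.F β := (P.F_nonneg _).trans_lt hlt
    refine ⟨(P.F β - P.F (β - a • g)) / P.F β, div_pos (by linarith) hpos, ?_⟩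
    intro g' a' hg' _ ha' ε hε
    obtain rfl := hg.eq hg'
    rw [ha'.F_eq ha]
    rw [lt_div_iff₀ hpos] at hε
    linarith
  · exact ⟨1, one_pos, fun g a hg h0 ha => absurd ⟨g, a, hg, h0, ha⟩ hex⟩

lemma Problem.exists_uniform_progress_tolerance (P : Problem d p m) {M : Set (Coef p m)}
    (hM : M.Finite) :
    ∃ δ : ℝ, 0 < δ ∧ ∀ β ∈ M, ∀ (g : Coef p m) (a : ℝ), P.IsMinNormSubgradient β g → g ≠ 0 →
      P.IsExactStep β g a → ∀ ε < δ, P.F (β - a • g) < (1 - ε) * P.F β := by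
  induction M, hM using Set.Finite.induction_on with
  | empty => exact ⟨1, one_pos, by simp⟩
  | @insert β M _ _ ih =>
    obtain ⟨δ₁, h₁, h₁'⟩ := ih
    obtain ⟨δ₂, h₂, h₂'⟩ := P.exists_progress_tolerance β
    refine ⟨min δ₁ δ₂, lt_min h₁ h₂, ?_⟩
    rintro γ (rfl | hγ) g a hg h0 ha ε hε
    · exact h₂' g a hg h0 ha ε (hε.trans_le (min_le_right _ _))
    · exact h₁' γ hγ g a hg h0 ha ε (hε.trans_le (min_le_left _ _))

lemma Problem.IsRun.allChains_of_subgradient {P : Problem d p m} {ε : ℝ} {ph : ℕ → Phase}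
    {β : ℕ → Coef p m} (h : P.IsRun ε ph β) {n : ℕ} (hn : ph (n + 1) = .subgradient) :
    ph n = .allChains ∧ ∀ g, P.IsMinNormSubgradient (β (n + 1)) g → g ≠ 0 := by
  by_cases h₀ : ph n = .finished ∨ ph n = .stopped
  · have := (h.halt n h₀).1
    rcases h₀ with h₀ | h₀ <;> simp [this, h₀] at hn
  push Not at h₀
  have hs := h.step n h₀.1 h₀.2
  rw [hn] at hs
  generalize ph n = q at hs ⊢
  generalize β (n + 1) = x' at hs ⊢
  cases hs with
  | allChains_nonzero _ hg h0 => exact ⟨rfl, fun g' hg' => hg.eq hg' ▸ h0⟩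

lemma Problem.IsRun.ne_stopped {P : Problem d p m} {ε : ℝ} {ph : ℕ → Phase}
    {β : ℕ → Coef p m} (h : P.IsRun ε ph β) {M : Set (Coef p m)}
    (hM : ∀ n, ph n = .allChains → β (n + 1) ∈ M)
    (hε : ∀ β ∈ M, ∀ (g : Coef p m) (a : ℝ), P.IsMinNormSubgradient β g → g ≠ 0 →
      P.IsExactStep β g a → P.F (β - a • g) < (1 - ε) * P.F β) (n : ℕ) :
    ph n ≠ .stopped := by
  induction n with
  | zero => simp [h.init]
  | succ n ih =>
    intro hn
    by_cases h₁ : ph n = .finished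
    · rw [(h.halt n (.inl h₁)).1, h₁] at hn
      simp at hn
    have hs := h.step n h₁ ih
    rw [hn] at hs
    generalize hq : ph n = q at hs
    generalize hx : β n = x at hs
    generalize β (n + 1) = x' at hs
    cases hs with
    | subgradient_stopped hg ha hle =>
      subst hx
      obtain ⟨n, rfl⟩ := Nat.exists_eq_succ_of_ne_zero (n := n) (by
        rintro rfl
        simp [h.init] at hq)
      obtain ⟨hc, h0⟩ := h.allChains_of_subgradient hq
      exact absurd (hε _ (hM n hc) _ _ hg (h0 _ hg) ha) (not_lt.2 hle)

end SGFL

theorem theorem2 {d p m : ℕ} (P : SGFL.Problem d p m) :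
    -- The tolerance is decreased whenever the stopping test is met at a nonoptimal point;
    -- no restriction on the exact minimizers that the solvers return.
    (∀ ε : ℕ → ℝ, (∀ k, 0 < ε k) →
      ∀ (β₀ : SGFL.Coef p m) (k : ℕ → ℕ) (ph : ℕ → SGFL.Phase) (β : ℕ → SGFL.Coef p m),
        β 0 = β₀ → P.IsContinuedRun ε k ph β → P.ConvergesToMin β) ∧
    -- The tolerance is fixed and small, and the third level returns minimizers from a finite set
    -- fixed in advance (such as one minimizer for each segmentation).
    (∀ M : Set (SGFL.Coef p m), M.Finite →
      ∃ ε₀ : ℝ, 0 < ε₀ ∧ ∀ ε : ℝ, 0 < ε → ε < ε₀ →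
        ∀ (β₀ : SGFL.Coef p m) (ph : ℕ → SGFL.Phase) (β : ℕ → SGFL.Coef p m),
          β 0 = β₀ → P.IsRun ε ph β →
          (∀ n, ph n = SGFL.Phase.allChains → β (n + 1) ∈ M) →
            (∀ n, ph n ≠ SGFL.Phase.stopped) ∧ P.ConvergesToMin β) := by
  refine ⟨fun ε hε _ k ph β _ h => h.convergesToMin hε, fun M hM => ?_⟩
  obtain ⟨δ, hδ, hδM⟩ := P.exists_uniform_progress_tolerance hM
  refine ⟨δ, hδ, fun ε hε hεδ _ ph β _ h hout => ?_⟩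
  have hns := h.ne_stopped hout fun γ hγ g a hg h0 ha => hδM γ hγ g a hg h0 ha ε hεδ
  refine ⟨hns, ?_⟩
  -- a run that never stops in the fourth level is a continued run without restarts
  have hc : P.IsContinuedRun (fun _ => ε) (fun _ => 0) ph β :=
    { init := ⟨h.init, rfl⟩
      step := fun n h₁ h₂ => ⟨h.step n h₁ h₂, rfl⟩
      restart := fun n hn => absurd hn (hns n)
      halt := fun n hn => by
        have := h.halt n (.inl hn)
        exact ⟨this.1.trans hn, this.2, rfl⟩ }
  exact hc.convergesToMin fun _ => hε
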